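/- **Proposition 6.2 (Private gradient descent with filtering).** *Rényi differential privacy.* For probability measures $\mu,\nu$, let $D_\alpha(\mu\|\nu)=\frac{1}{\alpha-1}\log\int\left(\frac{d\mu}{d\nu}\right)^{\alpha}d\nu$ for $\alpha>1$ if $\mu\ll\nu$, and $D_\alpha(\mu\|\nu)=\infty$ for $\alpha>1$ if $\mu\not\ll\nu$; let $D_1$ be the Kullback–Leibler divergence. A randomized algorithm $\mathcal A$, whose inputs are finite tuples of points of a set $\mathcal X$ (of any size), is $(\alpha,\rho)$-RDP if for every dataset $S=(X_1,\dots,X_s)$ and every $i$, with $S^{-i}$ obtained from $S$ by removing $X_i$, both $D_\alpha(\mathcal A(S)\|\mathcal A(S^{-i}))\le\rho$ and $D_\alpha(\mathcal A(S^{-i})\|\mathcal A(S))\le\rho$, where $\mathcal A(S)$ stands for the law of the output. *The algorithm.* Fix the following inputs, none of which depends on the dataset: a loss function $\ell:\mathbb R^d\times\mathcal X\to\mathbb R$, an arbitrary initial point $\theta_1\in\mathbb R^d$, learning rates $\eta_t\in\mathbb R$, a noise scale $\sigma>0$, a clip value $C>0$, a squared norm budget $B_{\mathrm{norm}}>0$,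 a number of steps $k_{\max}\in\mathbb N$, a nominal dataset size $n\ge1$ used for averaging, and a number $m\ge 1$ of noise vectors per step ($m=n$: one for each of the $n$ nominal points; $m=1$: one for the whole sum). On a dataset $S=(X_1,\dots,X_s)$, for $t=1,\dots,k_{\max}$ and all $i$, set $g_t(X_i)=\nabla_\theta\ell(\theta_t;X_i)$ (read as $0$ if $\ell(\cdot;X_i)$ is not differentiable at $\theta_t$), $$\bar g_t(X_i)=g_t(X_i)\cdot\min\left(1,\frac{\min\left(C,\sqrt{B_{\mathrm{norm}}-\sum_{j=1}^{t-1}\|\bar g_j(X_i)\|_2^2}\right)}{\|g_t(X_i)\|_2}\right)$$ (so $\bar g_t(X_i)=0$ if $g_t(X_i)=0$), and $$\widetilde g_t=\frac1n\left(\sum_{i=1}^{s}\bar g_t(X_i)+\sum_{l=1}^{m}\xi_{t,l}\right),\qquad \theta_{t+1}=\theta_t-\eta_t\widetilde g_t,$$ where the $\xi_{t,l}\sim N(0,\sigma^2C^2\mathbb I_d)$ are independent. The output is $\theta_{k_{\max}+1}$. *Claim.* For all such inputs and every real $\alpha\ge1$, this algorithm is $\left(\alpha,\frac{\alpha B_{\mathrm{norm}}}{2\sigma^2C^2}\right)$-RDP.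 In particular the guarantee does not depend on $k_{\max}$. -/

import Mathlib

open MeasureTheory ProbabilityTheory

noncomputable section

/-- Rényi divergence `D_α(μ ‖ ν)` of order `α ≥ 1` between probability measures, with values in
`[-∞, ∞]`.  For `α > 1` it is `(α - 1)⁻¹ log ∫ (dμ/dν)^α dν` if `μ ≪ ν` and `∞` otherwise; for
`α = 1` it is the Kullback-Leibler divergence. -/
def renyiDiv {Y : Type*} [MeasurableSpace Y] (α : ℝ) (μ ν : Measure Y) : EReal :=
  open scoped Classical in
  if α = 1 then (InformationTheory.klDiv μ ν : EReal)
  else if μ ≪ ν then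
    (((α - 1)⁻¹ : ℝ) : EReal) * ENNReal.log (∫⁻ y, (μ.rnDeriv ν y) ^ α ∂ν)
  else ⊤

/-- The larger of the two directions of the Rényi divergence. -/
def renyiDivSymm {Y : Type*} [MeasurableSpace Y] (α : ℝ) (μ ν : Measure Y) : EReal :=
  max (renyiDiv α μ ν) (renyiDiv α ν μ)

/-- `(α, ρ)`-Rényi differential privacy of a randomized algorithm `A`, which maps a dataset (a
finite tuple of points, of any size) to the law of its output: removing any one entry from any
dataset changes the output law by at most `ρ` in Rényi divergence of order `α`, in both
directions. -/
def IsRDP {X Y : Type*} [MeasurableSpace Y] (A : List X → Measure Y) (α ρ : ℝ) : Prop :=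
  ∀ (S : List X) (i : Fin S.length), renyiDivSymm α (A S) (A (S.eraseIdx i)) ≤ (ρ : EReal)

/-- The centered Gaussian law `N(0, s² I)` on `ℝᵈ`. -/
def isoGaussian (d : ℕ) (s : ℝ) : Measure (EuclideanSpace ℝ (Fin d)) :=
  (stdGaussian (EuclideanSpace ℝ (Fin d))).map (fun z => s • z)

instance (d : ℕ) (s : ℝ) : IsProbabilityMeasure (isoGaussian d s) :=
  Measure.isProbabilityMeasure_map (by fun_prop)

/-- The vector `g` rescaled to norm at most `c`: `g · min(1, c / ‖g‖)`. -/
def clip {d : ℕ} (c : ℝ) (g : EuclideanSpace ℝ (Fin d)) : EuclideanSpace ℝ (Fin d) :=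
  min 1 (c / ‖g‖) • g

/-- The inputs of private gradient descent with filtering other than the dataset.  All of them are
public, i.e. they do not depend on the dataset.  Steps are numbered from `0`. -/
structure FilteredGDInput (X : Type*) (d : ℕ) where
  /-- loss function `ℓ(θ; x)` -/
  loss : EuclideanSpace ℝ (Fin d) → X → ℝ
  /-- initial parameter vector -/
  init : EuclideanSpace ℝ (Fin d)
  /-- learning rates -/
  rate : ℕ → ℝ
  /-- noise scale -/
  σ : ℝ
  /-- clip value -/
  C : ℝ
  /-- squared norm budget of every data point -/
  Bnorm : ℝ
  /-- nominal size of the dataset, by which the noisy sum of gradients is divided -/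
  n : ℕ
  /-- number of independent `N(0, σ²C² I)` vectors added to the sum of gradients in each step: `n`
  if noise is added once per nominal data point, `1` if it is added once per step -/
  m : ℕ

namespace FilteredGDInput

variable {X : Type*} {d : ℕ} (P : FilteredGDInput X d)

/-- The clipped gradient at the point `x`, when the current parameter vector is `θ` and the clipped
gradients at `x` of the previous steps have squared norms adding up to `spent`. -/
def clippedGrad (θ : EuclideanSpace ℝ (Fin d)) (spent : ℝ) (x : X) :
    EuclideanSpace ℝ (Fin d) :=
  clip (min P.C (Real.sqrt (P.Bnorm - spent))) (gradient (fun ϑ => P.loss ϑ x) θ)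

/-- The state before step `t`, on the dataset `S`, when the noise vectors are `ξ` (those of step `t`
are `ξ (t, 0), …, ξ (t, m - 1)`): the parameter vector, and for each point `x` the sum of the squared
norms of its clipped gradients so far. -/
def state (S : List X) (ξ : ℕ × ℕ → EuclideanSpace ℝ (Fin d)) :
    ℕ → EuclideanSpace ℝ (Fin d) × (X → ℝ)
  | 0 => (P.init, fun _ => 0)
  | t + 1 =>
    let θ := (state S ξ t).1
    let spent := (state S ξ t).2
    let noisyGrad : EuclideanSpace ℝ (Fin d) :=
      (1 / (P.n : ℝ)) • ((S.map fun x => P.clippedGrad θ (spent x) x).sum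
        + ∑ l ∈ Finset.range P.m, ξ (t, l))
    (θ - P.rate t • noisyGrad, fun x => spent x + ‖P.clippedGrad θ (spent x) x‖ ^ 2)

theorem state_snd_eq_sum (S : List X) (ξ : ℕ × ℕ → EuclideanSpace ℝ (Fin d)) (t : ℕ) (x : X) :
    (P.state S ξ t).2 x = ∑ j ∈ Finset.range t,
      ‖P.clippedGrad (P.state S ξ j).1 ((P.state S ξ j).2 x) x‖ ^ 2 := by
  induction t with
  | zero => rfl
  | succ t ih => rw [Finset.sum_range_succ, ← ih]; rfl

/-- Private gradient descent with filtering: the law of the parameter vector that is returned after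
`k` steps on the dataset `S`, the noise vectors being independent with law `N(0, σ²C² I)`. -/
def filteredGD (k : ℕ) (S : List X) : Measure (EuclideanSpace ℝ (Fin d)) :=
  (Measure.infinitePi fun _ : ℕ × ℕ => isoGaussian d (P.σ * P.C)).map
    fun ξ => (P.state S ξ k).1

theorem measurable_state (S : List X) (t : ℕ) :
    Measurable fun ξ => P.state S ξ t := by
  have hc : ∀ x : X, Measurable fun p : EuclideanSpace ℝ (Fin d) × ℝ =>
      P.clippedGrad p.1 p.2 x := by
    intro x
    have hg : Measurable fun θ => gradient (fun ϑ => P.loss ϑ x) θ := by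
      unfold gradient
      exact (LinearIsometryEquiv.continuous _).measurable.comp (measurable_fderiv ℝ _)
    have hg' : Measurable fun p : EuclideanSpace ℝ (Fin d) × ℝ =>
        gradient (fun ϑ => P.loss ϑ x) p.1 := hg.comp measurable_fst
    unfold clippedGrad clip
    fun_prop
  induction t with
  | zero => exact measurable_const
  | succ t ih =>
    have hx : ∀ x : X, Measurable fun ξ =>
        P.clippedGrad (P.state S ξ t).1 ((P.state S ξ t).2 x) x := fun x =>
      (hc x).comp (ih.fst.prodMk ((measurable_pi_apply x).comp ih.snd))
    have hsum : ∀ L : List X, Measurable fun ξ =>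
        (L.map fun x => P.clippedGrad (P.state S ξ t).1 ((P.state S ξ t).2 x) x).sum := by
      intro L
      induction L with
      | nil => exact measurable_const
      | cons x L ih' =>
        simp only [List.map_cons, List.sum_cons]
        exact Measurable.add (hx x) ih'
    have h1 := hsum S
    have h2 := ih.fst
    have h3 : ∀ x, Measurable fun ξ => (P.state S ξ t).2 x :=
      fun x => (measurable_pi_apply x).comp ih.snd
    refine Measurable.prodMk ?_ (measurable_pi_lambda _ fun x => (h3 x).add ((hx x).norm.pow_const 2))
    have h4 : Measurable fun ξ : ℕ × ℕ → EuclideanSpace ℝ (Fin d) =>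
        ∑ l ∈ Finset.range P.m, ξ (t, l) := by fun_prop
    have h5 := Measurable.add h1 h4
    exact Measurable.sub h2 (Measurable.const_smul (Measurable.const_smul h5 (1 / (P.n : ℝ))) (P.rate t))

instance (k : ℕ) (S : List X) : IsProbabilityMeasure (P.filteredGD k S) :=
  Measure.isProbabilityMeasure_map (P.measurable_state S k).fst.aemeasurable

end FilteredGDInput

end

open scoped ENNReal

/-! The proof works with the dual form of Rényi divergence. For conjugate `α`, `β`, the density of
`μ` has `L^α(ν)` norm at most `K` as soon as `∫ φ dμ ≤ K (∫ φ^β dν)^(1/β)` for all measurable `φ ≥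
0`; inequalities of this kind can be chained step by step, with no conditional densities.

At a fixed state, removing a point `x` shifts the Gaussian noise by its clipped gradient `v`, which
costs a factor `exp((α - 1)‖v‖² / (2σ²C²))`. This cost is random, since it depends on the past. The
induction in `lintegral_state_le` therefore carries the weight `exp(-(α - 1) · spent / (2σ²C²))`,
where `spent` is the sum of the `‖v‖²` so far: each step multiplies the weight by exactly the
inverse of its cost, so the weighted inequality holds with constant 1 at all times. Only at the end
is `spent ≤ Bnorm` used to remove the weight, so the number of steps never enters.

The case `α = 1` is the limit of the bounds for `α > 1`. -/

/-! ### Duality: from bounds on integrals to Rényi divergence of order `α > 1`. -/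

theorem absolutelyContinuous_of_lintegral_le {Y : Type*} [MeasurableSpace Y] {μ ν : Measure Y}
    {β : ℝ} (hβ : 0 < β) {K : ℝ≥0∞}
    (h : ∀ φ : Y → ℝ≥0∞, Measurable φ → ∫⁻ y, φ y ∂μ ≤ K * (∫⁻ y, φ y ^ β ∂ν) ^ (1 / β)) :
    μ ≪ ν := by
  refine Measure.AbsolutelyContinuous.mk fun s hs hν => ?_
  have h1 := h (s.indicator 1) (measurable_one.indicator hs)
  have h2 : (fun y => s.indicator (1 : Y → ℝ≥0∞) y ^ β) = s.indicator 1 := by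
    ext y
    by_cases hy : y ∈ s <;> simp [hy, hβ]
  rw [h2, lintegral_indicator_one hs, lintegral_indicator_one hs, hν,
    ENNReal.zero_rpow_of_pos (by positivity), mul_zero] at h1
  exact le_antisymm h1 zero_le

/-- A bound on the expectations under `μ` by the `L^β` norms under `ν` bounds the `L^α` norm of
the density of `μ`, for conjugate exponents `α` and `β`. -/
theorem lintegral_rnDeriv_rpow_le {Y : Type*} [MeasurableSpace Y] {μ ν : Measure Y}
    [IsFiniteMeasure μ] [IsFiniteMeasure ν] {α β : ℝ} (hαβ : α.HolderConjugate β) {K : ℝ≥0∞}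
    (h : ∀ φ : Y → ℝ≥0∞, Measurable φ → ∫⁻ y, φ y ∂μ ≤ K * (∫⁻ y, φ y ^ β ∂ν) ^ (1 / β)) :
    ∫⁻ y, μ.rnDeriv ν y ^ α ∂ν ≤ K ^ α := by
  have hac := absolutelyContinuous_of_lintegral_le hαβ.symm.pos h
  have hα := hαβ.pos
  have hα1 := hαβ.lt
  have hr : Measurable (μ.rnDeriv ν) := Measure.measurable_rnDeriv μ ν
  -- Testing with `φ = min(dμ/dν, N)^(α - 1)` gives `J ≤ K * J^(1/β)`. Truncation makes `J` finite,
  -- so `J^(1/β)` can be cancelled; monotone convergence then removes `N`.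
  have htrunc : ∀ N : ℕ, ∫⁻ y, (min (μ.rnDeriv ν y) N) ^ α ∂ν ≤ K ^ α := by
    intro N
    set J := ∫⁻ y, (min (μ.rnDeriv ν y) N) ^ α ∂ν with hJ
    have hmeas : Measurable fun y => (min (μ.rnDeriv ν y) (N : ℝ≥0∞)) ^ (α - 1) := by fun_prop
    have h1 := h _ hmeas
    have h2 : ∀ y, ((min (μ.rnDeriv ν y) (N : ℝ≥0∞)) ^ (α - 1)) ^ β
        = (min (μ.rnDeriv ν y) (N : ℝ≥0∞)) ^ α := fun y => by
      rw [← ENNReal.rpow_mul, hαβ.sub_one_mul_conj]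
    simp only [h2] at h1
    rw [← lintegral_rnDeriv_mul hac hmeas.aemeasurable, ← hJ] at h1
    have h3 : J ≤ K * J ^ (1 / β) := by
      refine le_trans (lintegral_mono fun y => ?_) h1
      calc (min (μ.rnDeriv ν y) (N : ℝ≥0∞)) ^ α
          = min (μ.rnDeriv ν y) (N : ℝ≥0∞) * (min (μ.rnDeriv ν y) (N : ℝ≥0∞)) ^ (α - 1) := by
            conv_lhs => rw [show α = 1 + (α - 1) by ring]
            rw [ENNReal.rpow_add_of_nonneg _ _ zero_le_one (by linarith), ENNReal.rpow_one]
        _ ≤ _ := by gcongr; exact min_le_left _ _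
    have hJtop : J ≠ ∞ := by
      refine ne_top_of_le_ne_top ?_ (lintegral_mono (g := fun _ => (N : ℝ≥0∞) ^ α) fun y => ?_)
      · rw [lintegral_const]
        exact ENNReal.mul_ne_top (ENNReal.rpow_ne_top_of_nonneg hα.le (ENNReal.natCast_ne_top N))
          (measure_ne_top _ _)
      · dsimp only
        gcongr
        exact min_le_right _ _
    by_cases hJ0 : J = 0
    · simp [hJ0]
    have h4 : J ^ (1 / α) * J ^ (1 / β) = J := by
      rw [← ENNReal.rpow_add _ _ hJ0 hJtop, one_div, one_div, hαβ.inv_add_inv_eq_one,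
        ENNReal.rpow_one]
    have h5 : J ^ (1 / α) ≤ K := by
      rw [← ENNReal.mul_le_mul_iff_left (c := J ^ (1 / β)), h4]
      · exact h3
      · simp [ENNReal.rpow_eq_zero_iff, hJ0, hJtop]
      · exact ENNReal.rpow_ne_top_of_nonneg (one_div_nonneg.2 hαβ.symm.nonneg) hJtop
    calc J = (J ^ (1 / α)) ^ α := by
          rw [← ENNReal.rpow_mul, one_div_mul_cancel hα.ne', ENNReal.rpow_one]
      _ ≤ K ^ α := by gcongr
  have hlim : Filter.Tendsto (fun N : ℕ => ∫⁻ y, (min (μ.rnDeriv ν y) N) ^ α ∂ν) Filter.atTop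
      (nhds (∫⁻ y, μ.rnDeriv ν y ^ α ∂ν)) := by
    refine lintegral_tendsto_of_tendsto_of_monotone (fun N => by fun_prop) ?_ ?_
    · refine ae_of_all _ fun y a b hab => ?_
      dsimp only
      gcongr
    · refine ae_of_all _ fun y => ?_
      refine (ENNReal.continuous_rpow_const.tendsto _).comp ?_
      have := (tendsto_const_nhds (x := μ.rnDeriv ν y)).min ENNReal.tendsto_nat_nhds_top
      simpa using this
  exact le_of_tendsto' hlim htrunc

/-- The constant here bounds the `L^α` norm, so the integral of the `α`-th power is at most `exp(α
(α - 1) c)`; the normalisation `1 / (α - 1)` leaves `α * c`. -/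
theorem renyiDiv_le_of_lintegral_le {Y : Type*} [MeasurableSpace Y] {μ ν : Measure Y}
    [IsFiniteMeasure μ] [IsFiniteMeasure ν] {α β : ℝ} (hαβ : α.HolderConjugate β) {c : ℝ}
    (h : ∀ φ : Y → ℝ≥0∞, Measurable φ →
      ∫⁻ y, φ y ∂μ ≤ ENNReal.ofReal (Real.exp ((α - 1) * c)) * (∫⁻ y, φ y ^ β ∂ν) ^ (1 / β)) :
    renyiDiv α μ ν ≤ ((α * c : ℝ) : EReal) := by
  have hα1 := hαβ.lt
  have hint := lintegral_rnDeriv_rpow_le hαβ h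
  rw [renyiDiv, if_neg hα1.ne', if_pos (absolutelyContinuous_of_lintegral_le hαβ.symm.pos h)]
  rw [ENNReal.ofReal_rpow_of_pos (Real.exp_pos _), ← Real.exp_mul] at hint
  have hlog := ENNReal.log_monotone hint
  rw [ENNReal.log_ofReal_of_pos (Real.exp_pos _), Real.log_exp] at hlog
  calc _ ≤ (((α - 1)⁻¹ : ℝ) : EReal) * (((α - 1) * c * α : ℝ) : EReal) := by
        refine mul_le_mul_of_nonneg_left hlog ?_
        exact_mod_cast inv_nonneg.2 (sub_nonneg.2 hα1.le)
    _ = _ := by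
        rw [← EReal.coe_mul]
        congr 1
        have : α - 1 ≠ 0 := by linarith
        field_simp

/-! ### Kullback–Leibler divergence as the limit `α → 1`. -/

/-- This is `log y ≤ y - 1` at `y = x^(α - 1)`. Integrated against `ν`, it bounds the
Kullback–Leibler divergence by the `α`-th moment of the density. -/
theorem klFun_le_rpow {α x : ℝ} (hα : 1 < α) (hx : 0 ≤ x) :
    InformationTheory.klFun x ≤ (x ^ α - x) / (α - 1) + 1 - x := by
  rw [InformationTheory.klFun_apply]
  have hα0 : 0 < α - 1 := by linarith
  suffices x * Real.log x ≤ (x ^ α - x) / (α - 1) by linarith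
  rcases hx.eq_or_lt with rfl | hx
  · simp [Real.zero_rpow (by linarith : α ≠ 0)]
  rw [le_div_iff₀ hα0]
  have h1 := Real.log_le_sub_one_of_pos (Real.rpow_pos_of_pos hx (α - 1))
  rw [Real.log_rpow hx] at h1
  have h2 : x ^ α = x * x ^ (α - 1) := by
    rw [← Real.rpow_one_add' hx.le (by linarith)]
    ring_nf
  rw [h2]
  nlinarith

theorem klDiv_le_of_lintegral_rnDeriv_rpow_le {Y : Type*} [MeasurableSpace Y] {μ ν : Measure Y}
    [IsProbabilityMeasure μ] [IsProbabilityMeasure ν] (hac : μ ≪ ν) {α M : ℝ} (hα : 1 < α)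
    (hM : 0 ≤ M) (h : ∫⁻ y, μ.rnDeriv ν y ^ α ∂ν ≤ ENNReal.ofReal M) :
    InformationTheory.klDiv μ ν ≤ ENNReal.ofReal ((M - 1) / (α - 1)) := by
  have hα0 : 0 < α - 1 := by linarith
  rw [InformationTheory.klDiv_eq_lintegral_klFun_of_ac hac]
  have hmeas : Measurable fun y => (μ.rnDeriv ν y).toReal :=
    (Measure.measurable_rnDeriv μ ν).ennreal_toReal
  have hlint : ∫⁻ y, ENNReal.ofReal ((μ.rnDeriv ν y).toReal ^ α) ∂ν
      = ∫⁻ y, μ.rnDeriv ν y ^ α ∂ν := by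
    refine lintegral_congr_ae ?_
    filter_upwards [Measure.rnDeriv_ne_top μ ν] with y hy
    rw [← ENNReal.ofReal_rpow_of_nonneg ENNReal.toReal_nonneg (by linarith),
      ENNReal.ofReal_toReal hy]
  have hnn : 0 ≤ᵐ[ν] fun y => (μ.rnDeriv ν y).toReal ^ α :=
    ae_of_all _ fun y => Real.rpow_nonneg ENNReal.toReal_nonneg _
  have hint : Integrable (fun y => (μ.rnDeriv ν y).toReal ^ α) ν := by
    refine ⟨(by fun_prop : Measurable _).aestronglyMeasurable, ?_⟩
    rw [hasFiniteIntegral_iff_ofReal hnn, hlint]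
    exact h.trans_lt ENNReal.ofReal_lt_top
  have hint1 : Integrable (fun y => (μ.rnDeriv ν y).toReal) ν := Measure.integrable_toReal_rnDeriv
  have hbound : ∫ y, (μ.rnDeriv ν y).toReal ^ α ∂ν ≤ M := by
    rw [integral_eq_lintegral_of_nonneg_ae hnn hint.1, hlint]
    exact ENNReal.toReal_le_of_le_ofReal hM h
  have hint3 : Integrable (fun y => ((μ.rnDeriv ν y).toReal ^ α - (μ.rnDeriv ν y).toReal) / (α - 1))
      ν := (hint.sub hint1).div_const _
  have hint4 : Integrable (fun y => ((μ.rnDeriv ν y).toReal ^ α - (μ.rnDeriv ν y).toReal) / (α - 1)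
      + 1) ν := hint3.add (integrable_const _)
  have hint2 : Integrable (fun y => ((μ.rnDeriv ν y).toReal ^ α - (μ.rnDeriv ν y).toReal) / (α - 1)
      + 1 - (μ.rnDeriv ν y).toReal) ν := hint4.sub hint1
  have hone : ∫ y, (μ.rnDeriv ν y).toReal ∂ν = 1 := by
    rw [Measure.integral_toReal_rnDeriv hac]; simp
  have heq : ∫ y, ((μ.rnDeriv ν y).toReal ^ α - (μ.rnDeriv ν y).toReal) / (α - 1)
      + 1 - (μ.rnDeriv ν y).toReal ∂ν
      = ((∫ y, (μ.rnDeriv ν y).toReal ^ α ∂ν) - 1) / (α - 1) := by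
    rw [integral_sub hint4 hint1, integral_add hint3 (integrable_const _), integral_div,
      integral_sub hint hint1, hone]
    simp
  calc _ ≤ ∫⁻ y, ENNReal.ofReal (((μ.rnDeriv ν y).toReal ^ α - (μ.rnDeriv ν y).toReal) / (α - 1)
        + 1 - (μ.rnDeriv ν y).toReal) ∂ν :=
        lintegral_mono fun y => ENNReal.ofReal_le_ofReal (klFun_le_rpow hα ENNReal.toReal_nonneg)
    _ = ENNReal.ofReal (((∫ y, (μ.rnDeriv ν y).toReal ^ α ∂ν) - 1) / (α - 1)) := by
        rw [← heq, ofReal_integral_eq_lintegral_ofReal hint2]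
        exact ae_of_all _ fun y => (InformationTheory.klFun_nonneg ENNReal.toReal_nonneg).trans
          (klFun_le_rpow hα ENNReal.toReal_nonneg)
    _ ≤ _ := by gcongr

theorem klDiv_le_of_forall_lintegral_le {Y : Type*} [MeasurableSpace Y] {μ ν : Measure Y}
    [IsProbabilityMeasure μ] [IsProbabilityMeasure ν] {c : ℝ}
    (h : ∀ α β : ℝ, α.HolderConjugate β → ∀ φ : Y → ℝ≥0∞, Measurable φ →
      ∫⁻ y, φ y ∂μ ≤ ENNReal.ofReal (Real.exp ((α - 1) * c)) * (∫⁻ y, φ y ^ β ∂ν) ^ (1 / β)) :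
    InformationTheory.klDiv μ ν ≤ ENNReal.ofReal c := by
  have hα : ∀ x : ℝ, 0 < x → InformationTheory.klDiv μ ν
      ≤ ENNReal.ofReal ((Real.exp (x * c * (1 + x)) - 1) / x) := by
    intro x hx
    have hαβ := Real.HolderConjugate.conjExponent (p := 1 + x) (by linarith)
    have hb := h _ _ hαβ
    have hint := lintegral_rnDeriv_rpow_le hαβ hb
    rw [ENNReal.ofReal_rpow_of_pos (Real.exp_pos _), ← Real.exp_mul] at hint
    have := klDiv_le_of_lintegral_rnDeriv_rpow_le
      (absolutelyContinuous_of_lintegral_le hαβ.symm.pos hb) (by linarith) (Real.exp_pos _).le hint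
    simpa using this
  -- With `α = 1 + x`, the bound is a difference quotient at 0 of `x ↦ exp(x c (1 + x))`, whose
  -- derivative there is `c`.
  have hder : HasDerivAt (fun x : ℝ => Real.exp (x * c * (1 + x))) c 0 := by
    have h1 : HasDerivAt (fun x : ℝ => x * c * (1 + x)) c 0 := by
      have := ((hasDerivAt_id (0 : ℝ)).mul_const c).fun_mul ((hasDerivAt_id (0 : ℝ)).const_add 1)
      simpa using this
    simpa using h1.exp
  have hlim := hasDerivAt_iff_tendsto_slope.1 hder
  have hlim' : Filter.Tendsto (fun x : ℝ => (Real.exp (x * c * (1 + x)) - 1) / x)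
      (nhdsWithin 0 (Set.Ioi 0)) (nhds c) := by
    refine (hlim.mono_left (nhdsWithin_mono _ fun x hx => (ne_of_gt hx))).congr fun x => ?_
    simp [slope_def_field]
  refine ge_of_tendsto ((ENNReal.continuous_ofReal.tendsto c).comp hlim') ?_
  filter_upwards [self_mem_nhdsWithin] with x hx using hα x hx

/-! ### Translation bounds and their stability. -/

theorem lintegral_rpow_one_div_le {Y : Type*} [MeasurableSpace Y] {μ : Measure Y}
    [IsProbabilityMeasure μ] {β : ℝ} (hβ : 1 ≤ β) {f : Y → ℝ≥0∞} (hf : Measurable f) :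
    ∫⁻ y, f y ^ (1 / β) ∂μ ≤ (∫⁻ y, f y ∂μ) ^ (1 / β) := by
  have h := ENNReal.lintegral_mul_norm_pow_le (μ := μ) hf.aemeasurable
    (aemeasurable_const (b := (1 : ℝ≥0∞))) (p := 1 / β) (q := 1 - 1 / β) (by positivity)
    (by rw [sub_nonneg, div_le_one (by linarith)]; exact hβ) (by ring)
  simpa using h

/-- Translating by `v` changes integrals with respect to `ν` at most by the factor `K`, relative
to the `L^β` norm. -/
def TranslationBound {E : Type*} [MeasurableSpace E] [Add E] (ν : Measure E) (v : E) (K : ℝ≥0∞)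
    (β : ℝ) : Prop :=
  ∀ φ : E → ℝ≥0∞, Measurable φ → ∫⁻ x, φ (x + v) ∂ν ≤ K * (∫⁻ x, φ x ^ β ∂ν) ^ (1 / β)

/-- Extra independent noise does no harm: apply the bound conditionally on it, then Jensen for the
concave power `1/β`. -/
theorem TranslationBound.conv {E : Type*} [MeasurableSpace E] [AddCommMonoid E] [MeasurableAdd₂ E]
    {ν ρ : Measure E} [SFinite ν] [IsProbabilityMeasure ρ] {v : E} {K : ℝ≥0∞} {β : ℝ}
    (hβ : 1 ≤ β) (h : TranslationBound ν v K β) : TranslationBound (ρ ∗ ν) v K β := by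
  intro φ hφ
  rw [Measure.lintegral_conv (by fun_prop), Measure.lintegral_conv (by fun_prop)]
  have hmeas : Measurable fun y => ∫⁻ x, φ (y + x) ^ β ∂ν :=
    Measurable.lintegral_prod_right' (f := fun p : E × E => φ (p.1 + p.2) ^ β) (by fun_prop)
  calc ∫⁻ y, ∫⁻ x, φ (y + x + v) ∂ν ∂ρ
      ≤ ∫⁻ y, K * (∫⁻ x, φ (y + x) ^ β ∂ν) ^ (1 / β) ∂ρ := by
        refine lintegral_mono fun y => ?_
        simpa only [add_assoc] using h (fun x => φ (y + x)) (by fun_prop)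
    _ = K * ∫⁻ y, (∫⁻ x, φ (y + x) ^ β ∂ν) ^ (1 / β) ∂ρ := lintegral_const_mul _ (by fun_prop)
    _ ≤ _ := by gcongr; exact lintegral_rpow_one_div_le hβ hmeas

theorem TranslationBound.map {E F : Type*} [MeasurableSpace E] [MeasurableSpace F] [Add E] [Add F]
    [MeasurableAdd F] [MeasurableAdd E]
    {ν : Measure E} {v : E} {K : ℝ≥0∞} {β : ℝ} (h : TranslationBound ν v K β)
    {g : E → F} (hg : Measurable g) (hadd : ∀ x y, g (x + y) = g x + g y) :
    TranslationBound (ν.map g) (g v) K β := by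
  intro φ hφ
  rw [lintegral_map (by fun_prop) hg, lintegral_map (by fun_prop) hg]
  simpa only [hadd] using h (fun x => φ (g x)) (by fun_prop)

/-! ### Translation bounds for Gaussian laws. -/

theorem gaussianReal_eq_withDensity (a : ℝ) :
    gaussianReal a 1 = (gaussianReal 0 1).withDensity
      fun x => ENNReal.ofReal (Real.exp (a * x - a ^ 2 / 2)) := by
  rw [gaussianReal_of_var_ne_zero _ one_ne_zero, gaussianReal_of_var_ne_zero _ one_ne_zero,
    ← withDensity_mul _ (measurable_gaussianPDF _ _) (by fun_prop)]
  congr 1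
  ext x
  rw [Pi.mul_apply, gaussianPDF, gaussianPDF, ← ENNReal.ofReal_mul (gaussianPDFReal_nonneg _ _ _)]
  congr 1
  simp only [gaussianPDFReal, mul_assoc, ← Real.exp_add]
  congr 2
  simp
  ring

theorem lintegral_exp_mul_gaussianReal (t : ℝ) :
    ∫⁻ x, ENNReal.ofReal (Real.exp (t * x)) ∂gaussianReal 0 1
      = ENNReal.ofReal (Real.exp (t ^ 2 / 2)) := by
  rw [← ofReal_integral_eq_lintegral_ofReal (integrable_exp_mul_gaussianReal t)
    (ae_of_all _ fun x => (Real.exp_pos _).le)]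
  have := congrFun (mgf_id_gaussianReal (μ := 0) (v := 1)) t
  simp only [mgf, id] at this
  rw [this]
  simp

/-- Hölder applied to the density `exp(a x - a²/2)` of the shifted Gaussian. Its `L^α` norm has
exponent `(α² a²/2 - α a²/2) / α = (α - 1) a²/2`. -/
theorem translationBound_gaussianReal {α β : ℝ} (hαβ : α.HolderConjugate β) (a : ℝ) :
    TranslationBound (gaussianReal 0 1) a
      (ENNReal.ofReal (Real.exp ((α - 1) * (a ^ 2 / 2)))) β := by
  intro φ hφ
  have h1 : ∫⁻ x, φ (x + a) ∂gaussianReal 0 1 = ∫⁻ x, φ x ∂gaussianReal a 1 := by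
    rw [← lintegral_map hφ (measurable_add_const a), gaussianReal_map_add_const, zero_add]
  have hd : Measurable fun x : ℝ => ENNReal.ofReal (Real.exp (a * x - a ^ 2 / 2)) := by fun_prop
  rw [h1, gaussianReal_eq_withDensity, lintegral_withDensity_eq_lintegral_mul _ hd hφ]
  refine (ENNReal.lintegral_mul_le_Lp_mul_Lq _ hαβ hd.aemeasurable hφ.aemeasurable).trans_eq ?_
  congr 1
  have h2 : ∀ x : ℝ, ENNReal.ofReal (Real.exp (a * x - a ^ 2 / 2)) ^ α
      = ENNReal.ofReal (Real.exp (-(α * a ^ 2 / 2))) * ENNReal.ofReal (Real.exp (α * a * x)) := by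
    intro x
    rw [ENNReal.ofReal_rpow_of_pos (Real.exp_pos _), ← Real.exp_mul,
      ← ENNReal.ofReal_mul (Real.exp_pos _).le, ← Real.exp_add]
    congr 2
    ring
  simp only [h2]
  rw [lintegral_const_mul _ (by fun_prop), lintegral_exp_mul_gaussianReal,
    ← ENNReal.ofReal_mul (Real.exp_pos _).le, ← Real.exp_add,
    ENNReal.ofReal_rpow_of_pos (Real.exp_pos _), ← Real.exp_mul]
  congr 2
  have := hαβ.ne_zero
  field_simp
  ring

section StdGaussian

variable {E : Type*} [NormedAddCommGroup E] [InnerProductSpace ℝ E] [FiniteDimensional ℝ E]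
  [MeasurableSpace E] [BorelSpace E]

open scoped RealInnerProductSpace

/-- The standard Gaussian law is the convolution of its projections to a line and to the
orthogonal complement of that line. -/
theorem stdGaussian_eq_conv {e : E} (he : ‖e‖ = 1) :
    stdGaussian E = (stdGaussian E).map (fun x => x - ⟪e, x⟫ • e)
      ∗ (gaussianReal 0 1).map (fun r => r • e) := by
  have : IsProbabilityMeasure ((stdGaussian E).map (fun x => x - ⟪e, x⟫ • e)) :=
    Measure.isProbabilityMeasure_map (by fun_prop)
  have : IsProbabilityMeasure ((gaussianReal 0 1).map (fun r => r • e)) :=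
    Measure.isProbabilityMeasure_map (by fun_prop)
  -- The characteristic functions agree by Pythagoras, `h3`.
  apply Measure.ext_of_charFun
  ext t
  have h1 : charFun ((stdGaussian E).map (fun x => x - ⟪e, x⟫ • e)) t
      = charFun (stdGaussian E) (t - ⟪e, t⟫ • e) := by
    rw [charFun_apply, integral_map (by fun_prop) (by fun_prop), charFun_apply]
    congr! 4 with x
    rw [inner_sub_left, inner_sub_right, real_inner_smul_left, real_inner_smul_right,
      real_inner_comm e x]
    ring_nf
  have h2 : charFun ((gaussianReal 0 1).map (fun r => r • e)) t
      = charFun (gaussianReal 0 1) ⟪e, t⟫ := by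
    rw [charFun_apply, integral_map (by fun_prop) (by fun_prop), charFun_apply_real]
    congr! 3 with x
    rw [real_inner_smul_left]
    push_cast
    ring
  rw [charFun_conv, h1, h2, charFun_stdGaussian, charFun_stdGaussian, charFun_gaussianReal,
    ← Complex.exp_add]
  congr 1
  have h3 : ‖t - ⟪e, t⟫ • e‖ ^ 2 = ‖t‖ ^ 2 - ⟪e, t⟫ ^ 2 := by
    rw [norm_sub_sq_real, real_inner_smul_right, norm_smul, he, real_inner_comm e t,
      Real.norm_eq_abs, mul_one, sq_abs]
    ring
  rw [← Complex.ofReal_pow, ← Complex.ofReal_pow, h3]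
  push_cast
  ring

/-- Only the component along `v` is shifted, so the one-dimensional bound suffices; the orthogonal
component enters as a convolution. For `v = 0` there is no direction to split off, and the claim is
Jensen. -/
theorem translationBound_stdGaussian {α β : ℝ} (hαβ : α.HolderConjugate β) (v : E) :
    TranslationBound (stdGaussian E) v (ENNReal.ofReal (Real.exp ((α - 1) * (‖v‖ ^ 2 / 2)))) β := by
  have hβ : 1 ≤ β := hαβ.symm.lt.le
  rcases eq_or_ne v 0 with rfl | hv
  · intro φ hφ
    have h := lintegral_rpow_one_div_le (μ := stdGaussian E) hβ (hφ.pow_const β)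
    simp only [← ENNReal.rpow_mul, mul_one_div_cancel hαβ.symm.ne_zero, ENNReal.rpow_one] at h
    simpa using h
  have hv0 : ‖v‖ ≠ 0 := norm_ne_zero_iff.2 hv
  have he : ‖‖v‖⁻¹ • v‖ = 1 := by rw [norm_smul, norm_inv, norm_norm, inv_mul_cancel₀ hv0]
  have : IsProbabilityMeasure ((stdGaussian E).map
      (fun x => x - ⟪‖v‖⁻¹ • v, x⟫ • (‖v‖⁻¹ • v))) :=
    Measure.isProbabilityMeasure_map (by fun_prop)
  have h := ((translationBound_gaussianReal hαβ ‖v‖).map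
    (g := fun r : ℝ => r • (‖v‖⁻¹ • v)) (by fun_prop) fun x y => add_smul _ _ _).conv
    (ρ := (stdGaussian E).map (fun x => x - ⟪‖v‖⁻¹ • v, x⟫ • (‖v‖⁻¹ • v))) hβ
  rw [← stdGaussian_eq_conv he] at h
  simpa only [smul_smul, mul_inv_cancel₀ hv0, one_smul] using h

end StdGaussian

theorem translationBound_isoGaussian {α β : ℝ} (hαβ : α.HolderConjugate β) {d : ℕ} {s : ℝ}
    (hs : s ≠ 0) (v : EuclideanSpace ℝ (Fin d)) :
    TranslationBound (isoGaussian d s) v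
      (ENNReal.ofReal (Real.exp ((α - 1) * (‖v‖ ^ 2 / (2 * s ^ 2))))) β := by
  have h := (translationBound_stdGaussian hαβ (s⁻¹ • v)).map (g := fun z => s • z)
    (by fun_prop) fun x y => smul_add _ _ _
  rw [smul_smul, mul_inv_cancel₀ hs, one_smul, norm_smul, mul_pow, Real.norm_eq_abs, sq_abs] at h
  rwa [show s⁻¹ ^ 2 * ‖v‖ ^ 2 / 2 = ‖v‖ ^ 2 / (2 * s ^ 2) by field_simp] at h

/-! ### The algorithm as a recursion driven by independent noise. -/

namespace FilteredGDInput

variable {X : Type*} {d : ℕ} (P : FilteredGDInput X d)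

theorem norm_clip_le {c : ℝ} (hc : 0 ≤ c) (g : EuclideanSpace ℝ (Fin d)) : ‖clip c g‖ ≤ c := by
  have h0 : 0 ≤ min 1 (c / ‖g‖) := le_min zero_le_one (by positivity)
  rw [clip, norm_smul, Real.norm_eq_abs, abs_of_nonneg h0]
  calc min 1 (c / ‖g‖) * ‖g‖ ≤ c / ‖g‖ * ‖g‖ := by gcongr; exact min_le_right _ _
    _ ≤ c := by
      rcases eq_or_ne ‖g‖ 0 with h | h
      · simpa [h] using hc
      · rw [div_mul_cancel₀ _ h]

theorem norm_sq_clippedGrad_le (hC : 0 ≤ P.C) (θ : EuclideanSpace ℝ (Fin d)) {w : ℝ}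
    (hw : w ≤ P.Bnorm) (x : X) : ‖P.clippedGrad θ w x‖ ^ 2 ≤ P.Bnorm - w := by
  have h : ‖P.clippedGrad θ w x‖ ≤ Real.sqrt (P.Bnorm - w) :=
    (norm_clip_le (le_min hC (Real.sqrt_nonneg _)) _).trans (min_le_right _ _)
  calc ‖P.clippedGrad θ w x‖ ^ 2 ≤ Real.sqrt (P.Bnorm - w) ^ 2 := by gcongr
    _ = _ := Real.sq_sqrt (by linarith)

/-- The budget of a data point is never exceeded. -/
theorem state_snd_le (hC : 0 ≤ P.C) (hB : 0 ≤ P.Bnorm) (S : List X)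
    (ξ : ℕ × ℕ → EuclideanSpace ℝ (Fin d)) (t : ℕ) (x : X) : (P.state S ξ t).2 x ≤ P.Bnorm := by
  induction t with
  | zero => exact hB
  | succ t ih =>
    have := P.norm_sq_clippedGrad_le hC (P.state S ξ t).1 ih x
    change (P.state S ξ t).2 x
      + ‖P.clippedGrad (P.state S ξ t).1 ((P.state S ξ t).2 x) x‖ ^ 2 ≤ P.Bnorm
    linarith

/-- The sum of the clipped gradients over the dataset. -/
noncomputable def gradSum (S : List X) (s : EuclideanSpace ℝ (Fin d) × (X → ℝ)) : EuclideanSpace ℝ (Fin d) :=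
  (S.map fun x => P.clippedGrad s.1 (s.2 x) x).sum

/-- The state after step `t`, as a function of the state `s` before it and of the sum `z` of the
noise vectors. -/
noncomputable def step (S : List X) (t : ℕ) (s : EuclideanSpace ℝ (Fin d) × (X → ℝ))
    (z : EuclideanSpace ℝ (Fin d)) : EuclideanSpace ℝ (Fin d) × (X → ℝ) :=
  (s.1 - P.rate t • (1 / (P.n : ℝ)) • (P.gradSum S s + z),
    fun x => s.2 x + ‖P.clippedGrad s.1 (s.2 x) x‖ ^ 2)

theorem state_succ (S : List X) (ξ : ℕ × ℕ → EuclideanSpace ℝ (Fin d)) (t : ℕ) :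
    P.state S ξ (t + 1) = P.step S t (P.state S ξ t) (∑ l ∈ Finset.range P.m, ξ (t, l)) := rfl

/-- Changing the dataset amounts to translating the noise, because the record of spent budgets is
updated for every point of `X`, whether or not it lies in the dataset. -/
theorem step_eq_step_add (S S' : List X) (t : ℕ) (s : EuclideanSpace ℝ (Fin d) × (X → ℝ))
    (z : EuclideanSpace ℝ (Fin d)) :
    P.step S t s z = P.step S' t s (z + (P.gradSum S s - P.gradSum S' s)) := by
  rw [step, step, show P.gradSum S' s + (z + (P.gradSum S s - P.gradSum S' s))
    = P.gradSum S s + z by abel]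

theorem measurable_clippedGrad (x : X) :
    Measurable fun s : EuclideanSpace ℝ (Fin d) × (X → ℝ) => P.clippedGrad s.1 (s.2 x) x := by
  have hg : Measurable fun θ => gradient (fun ϑ => P.loss ϑ x) θ := by
    unfold gradient
    -- No regularity of the loss is needed: `fderiv` is measurable for an arbitrary function, being
    -- 0 where differentiability fails.
    exact (LinearIsometryEquiv.continuous _).measurable.comp (measurable_fderiv ℝ _)
  have hg' : Measurable fun s : EuclideanSpace ℝ (Fin d) × (X → ℝ) =>
      gradient (fun ϑ => P.loss ϑ x) s.1 := hg.comp measurable_fst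
  have hx : Measurable fun s : EuclideanSpace ℝ (Fin d) × (X → ℝ) => s.2 x :=
    (measurable_pi_apply x).comp measurable_snd
  unfold clippedGrad clip
  fun_prop

theorem measurable_gradSum (S : List X) : Measurable (P.gradSum S) := by
  unfold gradSum
  induction S with
  | nil => exact measurable_const
  | cons x S ih =>
    simp only [List.map_cons, List.sum_cons]
    exact (P.measurable_clippedGrad x).add ih

theorem measurable_step (S : List X) (t : ℕ) :
    Measurable fun p : (EuclideanSpace ℝ (Fin d) × (X → ℝ)) × EuclideanSpace ℝ (Fin d) =>
      P.step S t p.1 p.2 := by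
  have h1 := P.measurable_gradSum S
  refine Measurable.prodMk (by fun_prop) (measurable_pi_lambda _ fun x => ?_)
  have h2 : Measurable fun p : (EuclideanSpace ℝ (Fin d) × (X → ℝ)) × EuclideanSpace ℝ (Fin d) =>
      P.clippedGrad p.1.1 (p.1.2 x) x := (P.measurable_clippedGrad x).comp measurable_fst
  have h3 : Measurable fun p : (EuclideanSpace ℝ (Fin d) × (X → ℝ)) × EuclideanSpace ℝ (Fin d) =>
      p.1.2 x := (measurable_pi_apply x).comp (measurable_snd.comp measurable_fst)
  exact h3.add (h2.norm.pow_const 2)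

/-! ### Independence of the noise of different steps. -/

/-- The law of all the noise vectors. -/
noncomputable def noise : Measure (ℕ × ℕ → EuclideanSpace ℝ (Fin d)) :=
  Measure.infinitePi fun _ : ℕ × ℕ => isoGaussian d (P.σ * P.C)

instance : IsProbabilityMeasure P.noise := by unfold noise; infer_instance

theorem iIndepFun_noise : iIndepFun (fun (p : ℕ × ℕ) ξ => ξ p) P.noise :=
  iIndepFun_infinitePi (P := fun _ : ℕ × ℕ => isoGaussian d (P.σ * P.C)) (X := fun _ z => z)
    (fun _ => measurable_id)

/-- The state before step `t` depends only on the noise vectors of the earlier steps. -/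
theorem state_congr (S : List X) {ξ ξ' : ℕ × ℕ → EuclideanSpace ℝ (Fin d)} (t : ℕ)
    (h : ∀ p ∈ Finset.range t ×ˢ Finset.range P.m, ξ p = ξ' p) :
    P.state S ξ t = P.state S ξ' t := by
  induction t with
  | zero => rfl
  | succ t ih =>
    rw [state_succ, state_succ, ih fun p hp => h p ?_, Finset.sum_congr rfl fun l hl => h (t, l) ?_]
    · simpa using hl
    · simp only [Finset.mem_product, Finset.mem_range] at hp ⊢
      omega

theorem indepFun_state (S : List X) (t : ℕ) :
    IndepFun (fun ξ => P.state S ξ t) (fun ξ => ∑ l ∈ Finset.range P.m, ξ (t, l)) P.noise := by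
  have hdisj : Disjoint (Finset.range t ×ˢ Finset.range P.m) ({t} ×ˢ Finset.range P.m) := by
    rw [Finset.disjoint_left]
    intro p hp hp'
    simp only [Finset.mem_product, Finset.mem_range, Finset.mem_singleton] at hp hp'
    omega
  have hind := P.iIndepFun_noise.indepFun_finset _ _ hdisj fun p => measurable_pi_apply p
  -- Extending a finite family of noise vectors by 0 exhibits the state and the current noise sum as
  -- functions of disjoint subfamilies.
  let extend (F : Finset (ℕ × ℕ)) (w : F → EuclideanSpace ℝ (Fin d)) (p : ℕ × ℕ) :
      EuclideanSpace ℝ (Fin d) := if h : p ∈ F then w ⟨p, h⟩ else 0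
  have hext : ∀ F, Measurable (extend F) := by
    intro F
    refine measurable_pi_lambda _ fun p => ?_
    by_cases hp : p ∈ F
    · simpa [extend, hp] using measurable_pi_apply _
    · simp [extend, hp]
  have h := hind.comp ((P.measurable_state S t).comp (hext _))
    ((by fun_prop : Measurable fun ξ : ℕ × ℕ → EuclideanSpace ℝ (Fin d) =>
      ∑ l ∈ Finset.range P.m, ξ (t, l)).comp (hext _))
  convert h using 1
  · ext1 ξ
    refine P.state_congr S t fun p hp => ?_
    simp only [extend, dif_pos hp]
  · ext1 ξ
    refine Finset.sum_congr rfl fun l hl => ?_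
    have hp : (t, l) ∈ ({t} ×ˢ Finset.range P.m : Finset (ℕ × ℕ)) := by simpa using hl
    simp only [extend, dif_pos hp]

/-- The law of the sum of the noise vectors of step `t`. -/
noncomputable def stepNoise (t : ℕ) : Measure (EuclideanSpace ℝ (Fin d)) :=
  P.noise.map fun ξ => ∑ l ∈ Finset.range P.m, ξ (t, l)

instance (t : ℕ) : IsProbabilityMeasure (P.stepNoise t) :=
  Measure.isProbabilityMeasure_map (by fun_prop : Measurable _).aemeasurable

theorem translationBound_stepNoise {α β : ℝ} (hαβ : α.HolderConjugate β) (hs : P.σ * P.C ≠ 0)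
    (hm : 1 ≤ P.m) (t : ℕ) (v : EuclideanSpace ℝ (Fin d)) :
    TranslationBound (P.stepNoise t) v
      (ENNReal.ofReal (Real.exp ((α - 1) * (‖v‖ ^ 2 / (2 * (P.σ * P.C) ^ 2))))) β := by
  -- One of the noise vectors already gives the bound; the others are absorbed by
  -- `TranslationBound.conv`.
  obtain ⟨m, hm'⟩ : ∃ m, P.m = m + 1 := ⟨P.m - 1, by omega⟩
  have hind : iIndepFun (fun (l : ℕ) ξ => ξ (t, l)) P.noise :=
    P.iIndepFun_noise.precomp (g := fun l : ℕ => (t, l)) fun a b hab => by simpa using hab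
  have hlast : P.noise.map (fun ξ => ξ (t, m)) = isoGaussian d (P.σ * P.C) :=
    Measure.infinitePi_map_eval _ _
  have hconv : P.stepNoise t = (P.noise.map fun ξ => ∑ l ∈ Finset.range m, ξ (t, l))
      ∗ isoGaussian d (P.σ * P.C) := by
    have h := (hind.indepFun_sum_range_succ (fun l => measurable_pi_apply _) m)
    have h' := h.map_add_eq_map_conv_map (by fun_prop) (by fun_prop)
    rw [hlast] at h'
    rw [stepNoise, hm']
    convert h' using 2
    · ext1 ξ
      simp [Finset.sum_range_succ]
    · congr 1
      ext1 ξ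
      simp
  have : IsProbabilityMeasure (P.noise.map fun ξ => ∑ l ∈ Finset.range m, ξ (t, l)) :=
    Measure.isProbabilityMeasure_map (by fun_prop : Measurable _).aemeasurable
  rw [hconv]
  exact (translationBound_isoGaussian hαβ hs v).conv hαβ.symm.lt.le

theorem lintegral_state_succ (S : List X) (t : ℕ)
    {f : EuclideanSpace ℝ (Fin d) × (X → ℝ) → ℝ≥0∞} (hf : Measurable f) :
    ∫⁻ ξ, f (P.state S ξ (t + 1)) ∂P.noise
      = ∫⁻ ξ, ∫⁻ z, f (P.step S t (P.state S ξ t) z) ∂P.stepNoise t ∂P.noise := by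
  have hst := P.measurable_state S t
  have hz : Measurable fun ξ : ℕ × ℕ → EuclideanSpace ℝ (Fin d) =>
    ∑ l ∈ Finset.range P.m, ξ (t, l) := by fun_prop
  have hfs : Measurable fun p : (EuclideanSpace ℝ (Fin d) × (X → ℝ)) × EuclideanSpace ℝ (Fin d) =>
      f (P.step S t p.1 p.2) := hf.comp (P.measurable_step S t)
  have h := (indepFun_iff_map_prod_eq_prod_map_map hst.aemeasurable hz.aemeasurable).1
    (P.indepFun_state S t)
  have h1 : ∫⁻ ξ, f (P.state S ξ (t + 1)) ∂P.noise
      = ∫⁻ p, f (P.step S t p.1 p.2) ∂(P.noise.map fun ξ =>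
        (P.state S ξ t, ∑ l ∈ Finset.range P.m, ξ (t, l))) := by
    rw [lintegral_map hfs (hst.prodMk hz)]
    rfl
  rw [h1, h, lintegral_prod _ hfs.aemeasurable,
    lintegral_map (Measurable.lintegral_prod_right' hfs) hst]
  rfl

/-! ### The weighted induction and the privacy bound. -/

/-- The weight is a function of the state, so the inequality is closed under steps. Only the norm of
the difference of the gradient sums matters, which makes the statement serve both removal and
insertion of `x`. -/
theorem lintegral_state_le {S S' : List X} {x : X}
    (hS : ∀ s, ‖P.gradSum S s - P.gradSum S' s‖ = ‖P.clippedGrad s.1 (s.2 x) x‖)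
    {α β : ℝ} (hαβ : α.HolderConjugate β) (hs : P.σ * P.C ≠ 0) (hm : 1 ≤ P.m) (t : ℕ)
    {f : EuclideanSpace ℝ (Fin d) × (X → ℝ) → ℝ≥0∞} (hf : Measurable f) :
    ∫⁻ ξ, f (P.state S ξ t) * ENNReal.ofReal
        (Real.exp (-((α - 1) * ((P.state S ξ t).2 x / (2 * (P.σ * P.C) ^ 2))))) ∂P.noise
      ≤ (∫⁻ ξ, f (P.state S' ξ t) ^ β ∂P.noise) ^ (1 / β) := by
  set W : EuclideanSpace ℝ (Fin d) × (X → ℝ) → ℝ≥0∞ := fun s =>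
    ENNReal.ofReal (Real.exp (-((α - 1) * (s.2 x / (2 * (P.σ * P.C) ^ 2))))) with hW
  have hWm : Measurable W := by
    have hx : Measurable fun s : EuclideanSpace ℝ (Fin d) × (X → ℝ) => s.2 x :=
      (measurable_pi_apply x).comp measurable_snd
    fun_prop
  induction t generalizing f with
  | zero =>
    simp only [state, zero_div, mul_zero, neg_zero, Real.exp_zero, ENNReal.ofReal_one, mul_one,
      lintegral_const, measure_univ]
    rw [← ENNReal.rpow_mul, mul_one_div_cancel hαβ.symm.ne_zero, ENNReal.rpow_one]
  | succ t ih =>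
    have hstep : Measurable fun p : (EuclideanSpace ℝ (Fin d) × (X → ℝ)) ×
        EuclideanSpace ℝ (Fin d) => f (P.step S' t p.1 p.2) ^ β :=
      (hf.comp (P.measurable_step S' t)).pow_const β
    have hH : Measurable fun s => ∫⁻ z, f (P.step S' t s z) ^ β ∂P.stepNoise t :=
      hstep.lintegral_prod_right'
    have hinner : ∀ s, ∫⁻ z, f (P.step S t s z) * W (P.step S t s z) ∂P.stepNoise t
        ≤ (∫⁻ z, f (P.step S' t s z) ^ β ∂P.stepNoise t) ^ (1 / β) * W s := by
      intro s
      -- The budget spent after the step is determined by the state before it, so the new weight is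
      -- constant in `z`; its extra factor cancels the constant of the translation bound.
      have hconst : ∀ z, W (P.step S t s z) = ENNReal.ofReal (Real.exp (-((α - 1)
          * (‖P.gradSum S s - P.gradSum S' s‖ ^ 2 / (2 * (P.σ * P.C) ^ 2))))) * W s := by
        intro z
        rw [hS, hW, ← ENNReal.ofReal_mul (Real.exp_pos _).le, ← Real.exp_add]
        simp only [step]
        congr 2
        ring
      have hm1 : Measurable fun z => f (P.step S t s z) :=
        hf.comp ((P.measurable_step S t).comp (measurable_const.prodMk measurable_id))
      have hm2 : Measurable fun z => f (P.step S' t s z) :=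
        hf.comp ((P.measurable_step S' t).comp (measurable_const.prodMk measurable_id))
      simp only [hconst]
      rw [lintegral_mul_const _ hm1, ← mul_assoc]
      gcongr
      have h := P.translationBound_stepNoise hαβ hs hm t (P.gradSum S s - P.gradSum S' s) _ hm2
      simp only [← step_eq_step_add] at h
      calc _ ≤ _ := mul_le_mul_left h _
        _ = _ := by
          rw [mul_right_comm, ← ENNReal.ofReal_mul (Real.exp_pos _).le, ← Real.exp_add,
            add_neg_cancel, Real.exp_zero, ENNReal.ofReal_one, one_mul]
    have h1 := P.lintegral_state_succ S t (hf.mul hWm)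
    simp only [Pi.mul_apply] at h1
    rw [h1, P.lintegral_state_succ S' t (hf.pow_const β)]
    -- The induction hypothesis is used for the function `H^(1/β)`, `H` being the inner integral in
    -- `hH`; the outer power `β` then restores `H`.
    refine (lintegral_mono fun ξ => hinner (P.state S ξ t)).trans ((ih (hH.pow_const _)).trans_eq ?_)
    simp only [← ENNReal.rpow_mul, one_div_mul_cancel hαβ.symm.ne_zero, ENNReal.rpow_one]

theorem lintegral_filteredGD_le {S S' : List X} {x : X}
    (hS : ∀ s, ‖P.gradSum S s - P.gradSum S' s‖ = ‖P.clippedGrad s.1 (s.2 x) x‖)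
    {α β : ℝ} (hαβ : α.HolderConjugate β) (hσ : 0 < P.σ) (hC : 0 < P.C) (hB : 0 < P.Bnorm)
    (hm : 1 ≤ P.m) (k : ℕ) {φ : EuclideanSpace ℝ (Fin d) → ℝ≥0∞} (hφ : Measurable φ) :
    ∫⁻ y, φ y ∂P.filteredGD k S
      ≤ ENNReal.ofReal (Real.exp ((α - 1) * (P.Bnorm / (2 * (P.σ * P.C) ^ 2))))
        * (∫⁻ y, φ y ^ β ∂P.filteredGD k S') ^ (1 / β) := by
  have hα := hαβ.lt
  rw [filteredGD, filteredGD, lintegral_map hφ (P.measurable_state S k).fst,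
    lintegral_map (by fun_prop) (P.measurable_state S' k).fst]
  have h := P.lintegral_state_le hS hαβ (by positivity) hm k
    (f := fun s => φ s.1) (by fun_prop)
  refine le_trans ?_ (mul_le_mul_right h _)
  rw [← lintegral_const_mul' _ _ ENNReal.ofReal_ne_top]
  refine lintegral_mono fun ξ => ?_
  rw [mul_left_comm, ← ENNReal.ofReal_mul (Real.exp_pos _).le, ← Real.exp_add]
  -- The weight times the final constant is at least 1, because the spent budget never exceeds
  -- `Bnorm`.
  refine le_mul_of_one_le_right' ?_
  rw [ENNReal.one_le_ofReal, Real.one_le_exp_iff, ← sub_eq_add_neg, ← mul_sub, ← sub_div]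
  have := P.state_snd_le hC.le hB.le S ξ k x
  exact mul_nonneg (by linarith) (div_nonneg (by linarith) (by positivity))

theorem renyiDiv_filteredGD_le {S S' : List X} {x : X}
    (hS : ∀ s, ‖P.gradSum S s - P.gradSum S' s‖ = ‖P.clippedGrad s.1 (s.2 x) x‖)
    {α : ℝ} (hα : 1 ≤ α) (hσ : 0 < P.σ) (hC : 0 < P.C) (hB : 0 < P.Bnorm)
    (hm : 1 ≤ P.m) (k : ℕ) :
    renyiDiv α (P.filteredGD k S) (P.filteredGD k S')
      ≤ ((α * (P.Bnorm / (2 * (P.σ * P.C) ^ 2)) : ℝ) : EReal) := by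
  rcases hα.eq_or_lt with rfl | hα
  · rw [renyiDiv, if_pos rfl, one_mul]
    have h := klDiv_le_of_forall_lintegral_le fun α β hαβ φ hφ =>
      P.lintegral_filteredGD_le hS hαβ hσ hC hB hm k hφ
    refine (EReal.coe_ennreal_le_coe_ennreal_iff.2 h).trans_eq ?_
    rw [EReal.coe_ennreal_ofReal, max_eq_left (by positivity)]
  · have hαβ := Real.HolderConjugate.conjExponent hα
    exact renyiDiv_le_of_lintegral_le hαβ fun φ hφ =>
      P.lintegral_filteredGD_le hS hαβ hσ hC hB hm k hφ

/-- At a common state, the clipped gradients of the remaining points coincide and cancel. -/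
theorem gradSum_sub_gradSum_eraseIdx (S : List X) (i : Fin S.length)
    (s : EuclideanSpace ℝ (Fin d) × (X → ℝ)) :
    P.gradSum S s - P.gradSum (S.eraseIdx i) s = P.clippedGrad s.1 (s.2 S[i]) S[i] := by
  have h := ((List.getElem_cons_eraseIdx_perm i.2).map
    fun x => P.clippedGrad s.1 (s.2 x) x).sum_eq
  rw [List.map_cons, List.sum_cons] at h
  rw [gradSum, gradSum, ← h]
  simp

end FilteredGDInput

theorem proposition6p2 {X : Type*} {d : ℕ} (P : FilteredGDInput X d)
    (hσ : 0 < P.σ) (hC : 0 < P.C) (hB : 0 < P.Bnorm) (hn : 1 ≤ P.n) (hm : 1 ≤ P.m)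
    (kmax : ℕ) (α : ℝ) (hα : 1 ≤ α) :
    IsRDP (P.filteredGD kmax) α (α * P.Bnorm / (2 * P.σ ^ 2 * P.C ^ 2)) := by
  intro S i
  rw [show α * P.Bnorm / (2 * P.σ ^ 2 * P.C ^ 2) = α * (P.Bnorm / (2 * (P.σ * P.C) ^ 2)) by ring]
  have h := P.gradSum_sub_gradSum_eraseIdx S i
  refine max_le (P.renyiDiv_filteredGD_le (x := S[i]) (fun s => ?_) hα hσ hC hB hm kmax)
    (P.renyiDiv_filteredGD_le (x := S[i]) (fun s => ?_) hα hσ hC hB hm kmax)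
  · rw [h]
  · rw [norm_sub_rev, h]
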